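/- Let $n\ge 1$, let $m=2^n-1$ be the number of nonempty coalitions $S\subseteq N=\{1,\dots,n\}$, and let $v(t)\in\mathbb R^m$, $t\ge 0$, be a jointly measurable bounded mean ergodic process: all $v(t)$ have the same law $\mathbb P$, carried by a bounded convex set $\mathcal V\subset\mathbb R^m$, and $\mathbb E[v(t)]=v_{nom}=\lim_{\tau\to\infty}\frac1\tau\int_0^\tau v$ almost surely. Let $B_{\mathcal H}\in\{0,1\}^{m\times n}$ be the matrix whose rows are the characteristic vectors of the coalitions, with the grand coalition last, and let $B=\left[B_{\mathcal H}\ \Big|\ \begin{smallmatrix}-I_{m-1}\\0\end{smallmatrix}\right]$. Let $U$ be the set of controls $u=(a,s)\in\mathbb R^n\times\mathbb R^{m-1}$ with $a_{min}\le a\le a_{max}$ and $s\ge 0$. Let $a_{nom}$ be a point of the core $C(v_{nom})$ and $u_{nom}=(a_{nom},s_{nom})\in U$ with $Bu_{nom}=v_{nom}$. Let $B^\dagger,C,F$ be matrices with $\begin{bmatrix}B\\C\end{bmatrix}\begin{bmatrix}B^\dagger&F\end{bmatrix}=I$. Let $(x(t),y(t))$ be a solution, in the integrated sense and with continuous paths,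 of $$\dot x=B\,\Delta u-\Delta v,\qquad \dot y=C\,\Delta u,\qquad \Delta v=v-v_{nom},\qquad \Delta u=\mathrm{sat}_{[\Delta u^{min},\Delta u^{max}]}(-z),\qquad z=B^\dagger x+Fy,$$ where $\Delta u^{min}=(a_{min}-a_{nom},-s_{nom})$ and $\Delta u^{max}=(a_{max}-a_{nom},+\infty)$ are the extreme deviations for which $u_{nom}+\Delta u\in U$, and saturation acts coordinatewise. Assume that $x(0),y(0)$ are square integrable, that for every $t\ge0$ the fluctuation $\Delta v(t)$ is independent of $x(t)$ and independent of $y(t)$, and that either $a_{min}<a_{nom}<a_{max}$ and $s_{nom}>0$ in every coordinate, or $x(0)=0$ and $y(0)=0$ almost surely. Put $u(t)=(a(t),s(t))=u_{nom}+\Delta u(t)$, and let $\epsilon(t)=\epsilon(0)+\int_0^t (B_{\mathcal H}a-v)$ be the vector of coalition excesses. Then $u(t)\in U$ for all $t$, and almost surely, as $t\to\infty$: 1. $x(t)\to0$; 2. $\frac1t\int_0^t a\to a_{nom}$; 3. the excesses follow the direction $s_{nom}t$: $\epsilon(t)/t\to(s_{nom},0)$, and $\epsilon(t)-\left(\int_0^t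 s,\,0\right)\to\epsilon(0)-x(0)$, where the entry $0$ belongs to the grand coalition. If moreover $x(0)=0$, $y(0)=0$ and $\epsilon(0)=0$ almost surely, then $\epsilon(t)-t\,(s_{nom},0)\to 0$. -/

import Mathlib

open MeasureTheory ProbabilityTheory Filter Topology

namespace DynamicTU

/-- The nonempty coalitions of the player set `Fin n` (there are `m = 2 ^ n - 1` of them). -/
abbrev Coalition (n : ℕ) : Type := {S : Finset (Fin n) // S.Nonempty}

/-- The nonempty coalitions other than the grand coalition (there are `m - 1` of them). -/
abbrev ProperCoalition (n : ℕ) : Type :=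
  {S : Finset (Fin n) // S.Nonempty ∧ S ≠ Finset.univ}

/-- Coordinates of a control `u = (a, s)`: `n` allocations followed by `m - 1` surpluses. -/
abbrev ControlIdx (n : ℕ) : Type := Fin n ⊕ ProperCoalition n

/-- The core of the TU game with characteristic vector `v`: efficient allocations
that give every coalition at least its value. -/
def core {n : ℕ} (v : Coalition n → ℝ) : Set (Fin n → ℝ) :=
  {a | (∀ S : Coalition n, v S ≤ ∑ i ∈ S.1, a i) ∧
       ∀ S : Coalition n, S.1 = Finset.univ → ∑ i ∈ S.1, a i = v S}

/-- The incidence matrix: its rows are the characteristic vectors of the coalitions. -/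
def incidence (n : ℕ) : Matrix (Coalition n) (Fin n) ℝ :=
  Matrix.of fun S i => if i ∈ S.1 then 1 else 0

/-- The surplus columns: minus the identity on the proper coalitions, and a zero row for the
grand coalition. -/
def surplusBlock (n : ℕ) : Matrix (Coalition n) (ProperCoalition n) ℝ :=
  Matrix.of fun S T => if S.1 = T.1 then -1 else 0

/-- The `m × (n + m - 1)` matrix `B`. -/
def flowMatrix (n : ℕ) : Matrix (Coalition n) (ControlIdx n) ℝ :=
  Matrix.fromCols (incidence n) (surplusBlock n)

/-- The feasible controls `u = (a, s)`: `aMin ≤ a ≤ aMax` and `s ≥ 0`. -/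
def feasible {n : ℕ} (aMin aMax : Fin n → ℝ) : Set (ControlIdx n → ℝ) :=
  {u | (∀ i : Fin n, aMin i ≤ u (Sum.inl i) ∧ u (Sum.inl i) ≤ aMax i) ∧
       ∀ S : ProperCoalition n, 0 ≤ u (Sum.inr S)}

/-- Scalar saturation to the interval `[lo, hi]`, whose end points may be infinite. -/
noncomputable def sat (lo hi : EReal) (ξ : ℝ) : ℝ :=
  if hi < (ξ : EReal) then hi.toReal else if (ξ : EReal) < lo then lo.toReal else ξ

/-- The smallest admissible deviation from `uNom` in each coordinate. -/
noncomputable def duMin {n : ℕ} (aMin : Fin n → ℝ) (uNom : ControlIdx n → ℝ) :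
    ControlIdx n → EReal :=
  Sum.elim (fun i => ((aMin i - uNom (Sum.inl i) : ℝ) : EReal))
    (fun S => ((-uNom (Sum.inr S) : ℝ) : EReal))

/-- The largest admissible deviation from `uNom` in each coordinate; a surplus is not bounded
from above. -/
noncomputable def duMax {n : ℕ} (aMax : Fin n → ℝ) (uNom : ControlIdx n → ℝ) :
    ControlIdx n → EReal :=
  Sum.elim (fun i => ((aMax i - uNom (Sum.inl i) : ℝ) : EReal)) (fun _ => ⊤)

/-- The deviation `Δu = sat (-z)`, saturated coordinate by coordinate. -/
noncomputable def deviation {n : ℕ} (aMin aMax : Fin n → ℝ) (uNom z : ControlIdx n → ℝ) :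
    ControlIdx n → ℝ :=
  fun j => sat (duMin aMin uNom j) (duMax aMax uNom j) (-z j)

/-- The full-information controller `uNom + sat (-z)`. -/
noncomputable def controller {n : ℕ} (aMin aMax : Fin n → ℝ) (uNom z : ControlIdx n → ℝ) :
    ControlIdx n → ℝ :=
  uNom + deviation aMin aMax uNom z

/-- `z = [B† F] (x, y)`. -/
def zState {n : ℕ} (Bd : Matrix (ControlIdx n) (Coalition n) ℝ)
    (F : Matrix (ControlIdx n) (Fin (n - 1)) ℝ) (x : Coalition n → ℝ) (y : Fin (n - 1) → ℝ) :
    ControlIdx n → ℝ :=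
  Matrix.mulVec Bd x + Matrix.mulVec F y

/-- The time average `(1 / t) ∫₀ᵗ f`. -/
noncomputable def timeAvg {ι : Type*} [Fintype ι] (f : ℝ → ι → ℝ) (t : ℝ) : ι → ℝ :=
  t⁻¹ • ∫ τ in (0 : ℝ)..t, f τ

/-- A surplus vector seen as a vector over all coalitions, with value `0` at the grand
coalition. -/
def extendSurplus {n : ℕ} (s : ProperCoalition n → ℝ) : Coalition n → ℝ :=
  fun S => if h : S.1 = Finset.univ then 0 else s ⟨S.1, S.2, h⟩

/-- `v` is a bounded mean ergodic process with long run average `vNom`: every `v t` has law `P`,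
which is carried by the bounded convex set `V`; every `v t` has mean `vNom`; and the time
averages of `v` converge to `vNom` almost surely. -/
structure IsBoundedMeanErgodic {n : ℕ} {Ω : Type*} [MeasurableSpace Ω] (μ : Measure Ω)
    (V : Set (Coalition n → ℝ)) (P : Measure (Coalition n → ℝ))
    (v : ℝ → Ω → Coalition n → ℝ) (vNom : Coalition n → ℝ) : Prop where
  bounded : Bornology.IsBounded V
  convex : Convex ℝ V
  measurable : Measurable fun p : ℝ × Ω => v p.1 p.2
  carried : ∀ᵐ w ∂P, w ∈ V
  law : ∀ t : ℝ, 0 ≤ t → Measure.map (v t) μ = P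
  mean : ∀ t : ℝ, 0 ≤ t → ∫ ω, v t ω ∂μ = vNom
  ergodic : ∀ᵐ ω ∂μ, Tendsto (timeAvg fun τ => v τ ω) atTop (𝓝 vNom)

/-- `(x, y)` is a (Carathéodory) solution of the closed loop
`x' = B Δu - (v - vNom)`, `y' = C Δu`, `Δu = sat (-z)`, `z = [B† F] (x, y)`:
for almost every outcome the paths are continuous and satisfy the integrated equations. -/
structure IsClosedLoop {n : ℕ} {Ω : Type*} [MeasurableSpace Ω] (μ : Measure Ω)
    (aMin aMax : Fin n → ℝ) (uNom : ControlIdx n → ℝ)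
    (C : Matrix (Fin (n - 1)) (ControlIdx n) ℝ)
    (Bd : Matrix (ControlIdx n) (Coalition n) ℝ)
    (F : Matrix (ControlIdx n) (Fin (n - 1)) ℝ)
    (v : ℝ → Ω → Coalition n → ℝ) (vNom : Coalition n → ℝ)
    (x : ℝ → Ω → Coalition n → ℝ) (y : ℝ → Ω → Fin (n - 1) → ℝ) : Prop where
  measurable_x : ∀ t : ℝ, 0 ≤ t → Measurable (x t)
  measurable_y : ∀ t : ℝ, 0 ≤ t → Measurable (y t)
  continuous_paths : ∀ᵐ ω ∂μ, ContinuousOn (fun t => x t ω) (Set.Ici 0) ∧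
    ContinuousOn (fun t => y t ω) (Set.Ici 0)
  eq_x : ∀ᵐ ω ∂μ, ∀ t : ℝ, 0 ≤ t → x t ω = x 0 ω + ∫ τ in (0 : ℝ)..t,
    (Matrix.mulVec (flowMatrix n)
      (deviation aMin aMax uNom (zState Bd F (x τ ω) (y τ ω))) - (v τ ω - vNom))
  eq_y : ∀ᵐ ω ∂μ, ∀ t : ℝ, 0 ≤ t → y t ω = y 0 ω + ∫ τ in (0 : ℝ)..t,
    Matrix.mulVec C (deviation aMin aMax uNom (zState Bd F (x τ ω) (y τ ω)))

/-- The excesses at time `t` along one outcome: initial excess plus accumulated rewards minus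
accumulated values, `ε_S(t) = ∑_{i ∈ S} ∫₀ᵗ a_i - ∫₀ᵗ v_S + ε_S(0)`. -/
noncomputable def excess {n : ℕ} (a : ℝ → Fin n → ℝ) (v : ℝ → Coalition n → ℝ)
    (ε₀ : Coalition n → ℝ) (t : ℝ) : Coalition n → ℝ :=
  fun S => ∑ i ∈ S.1, (∫ τ in (0 : ℝ)..t, a τ i) - (∫ τ in (0 : ℝ)..t, v τ S) + ε₀ S

end DynamicTU

/-! The change of variable from `(x, y)` to `z` decouples the loop. The two block matrices are
square, because m + (n - 1) = n + (m - 1), so they are inverse on both sides: x = Bz, y = Cz, and z'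
= Δu - B†Δv. Each coordinate thus solves a scalar equation z' = g(z) - w, where g(z) = sat(-z)
opposes z and w is bounded with mean zero.

The proof is an energy argument for this equation. Pathwise, (z²)' = 2 z g(z) - 2 z w. The current
state is uncorrelated with w, so in expectation E z(T)² + 2 E ∫₀ᵀ (-z g(z)) = E z(0)²
(`IsDampedProcess.integral_energy`), and the total dissipation is almost surely finite. Since |z|
grows at a bounded rate, every excursion to |z| ≥ δ costs a fixed amount of dissipation when zero is
interior to the saturation interval; hence z → 0. If instead z(0) = 0, the balance forces z ≡ 0 with
no interiority needed.

Then x = Bz → 0 and u → u_nom, and time averages follow by Cesàro. The excesses minus the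
accumulated surpluses differ from x only by the constant ε(0) - x(0), since Bu = B_H a - (s, 0). -/

namespace DynamicTU

/-! ### Damping feedbacks and scalar saturation -/

/-- A feedback law pointing towards the origin. -/
structure IsDamping (g : ℝ → ℝ) : Prop where
  continuous : Continuous g
  mul_nonpos : ∀ x, x * g x ≤ 0
  abs_le : ∀ x, |g x| ≤ |x|

/-- The dissipated power `-x g(x)` is bounded below away from the origin. -/
def IsStrictDamping (g : ℝ → ℝ) : Prop :=
  ∀ δ > 0, ∃ c > 0, ∀ x, δ ≤ |x| → c ≤ -(x * g x)

lemma sat_coe_coe {lo hi : ℝ} (h : lo ≤ hi) (ξ : ℝ) :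
    sat lo hi ξ = max lo (min hi ξ) := by
  unfold sat
  simp only [EReal.coe_lt_coe_iff, EReal.toReal_coe]
  grind

lemma sat_coe_top (lo ξ : ℝ) : sat lo ⊤ ξ = max lo ξ := by
  unfold sat
  simp only [EReal.coe_lt_coe_iff, EReal.toReal_coe, not_top_lt, if_false]
  grind

lemma isDamping_of_sign {g : ℝ → ℝ} (hc : Continuous g)
    (hpos : ∀ x, 0 ≤ x → -x ≤ g x ∧ g x ≤ 0) (hneg : ∀ x, x ≤ 0 → 0 ≤ g x ∧ g x ≤ -x) :
    IsDamping g where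
  continuous := hc
  mul_nonpos x := by
    rcases le_total 0 x with h | h
    · exact mul_nonpos_of_nonneg_of_nonpos h (hpos x h).2
    · exact mul_nonpos_of_nonpos_of_nonneg h (hneg x h).1
  abs_le x := by
    rcases le_total 0 x with h | h
    · rw [abs_of_nonneg h, abs_le]; constructor <;> linarith [hpos x h]
    · rw [abs_of_nonpos h, abs_le]; constructor <;> linarith [hneg x h]

/-- Here k is the level up to which the feedback is at least linear: the power is at least |x|
min(|x|, k). With k > 0 this excludes a saturation interval that has zero as an end point, which
damps on one side only. -/
lemma isStrictDamping_of_sign {g : ℝ → ℝ} {k : ℝ} (hk : 0 < k)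
    (hpos : ∀ x, 0 < x → g x ≤ -min x k) (hneg : ∀ x, x < 0 → min (-x) k ≤ g x) :
    IsStrictDamping g := by
  intro δ hδ
  have hm : 0 < min δ k := lt_min hδ hk
  refine ⟨δ * min δ k, mul_pos hδ hm, fun x hx => ?_⟩
  rcases lt_trichotomy x 0 with h | h | h
  · rw [abs_of_neg h] at hx
    have h1 := hneg x h
    have h2 : min δ k ≤ min (-x) k := min_le_min_right _ hx
    nlinarith
  · rw [h, abs_zero] at hx; linarith
  · rw [abs_of_pos h] at hx
    have h1 := hpos x h
    have h2 : min δ k ≤ min x k := min_le_min_right _ hx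
    nlinarith

lemma isDamping_sat_coe {lo hi : ℝ} (hlo : lo ≤ 0) (hhi : 0 ≤ hi) :
    IsDamping fun x => sat lo hi (-x) := by
  simp_rw [sat_coe_coe (hlo.trans hhi)]
  refine isDamping_of_sign (by fun_prop) (fun x hx => ?_) (fun x hx => ?_) <;> grind

lemma isDamping_sat_top {lo : ℝ} (hlo : lo ≤ 0) : IsDamping fun x => sat lo ⊤ (-x) := by
  simp_rw [sat_coe_top]
  refine isDamping_of_sign (by fun_prop) (fun x hx => ?_) (fun x hx => ?_) <;> grind

lemma isStrictDamping_sat_coe {lo hi : ℝ} (hlo : lo < 0) (hhi : 0 < hi) :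
    IsStrictDamping fun x => sat lo hi (-x) := by
  simp_rw [sat_coe_coe (hlo.trans hhi).le]
  refine isStrictDamping_of_sign (k := min (-lo) hi) (lt_min (by linarith) hhi)
    (fun x hx => ?_) (fun x hx => ?_) <;> grind

lemma isStrictDamping_sat_top {lo : ℝ} (hlo : lo < 0) :
    IsStrictDamping fun x => sat lo ⊤ (-x) := by
  simp_rw [sat_coe_top]
  refine isStrictDamping_of_sign (k := -lo) (by linarith)
    (fun x hx => ?_) (fun x hx => ?_) <;> grind

/-! ### Energy estimates along a single path -/

/-- `z` is a continuous solution on `[0, ∞)` of `z' = g(z) - w`, where `w` is bounded by `M`. -/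
structure IsDampedPath (g : ℝ → ℝ) (M : ℝ) (z w : ℝ → ℝ) : Prop where
  continuousOn : ContinuousOn z (Set.Ici 0)
  intervalIntegrable : ∀ t, 0 ≤ t → IntervalIntegrable w volume 0 t
  ae_bound : ∀ᵐ t, 0 ≤ t → |w t| ≤ M
  eq_integral : ∀ t, 0 ≤ t → z t = z 0 + ∫ τ in (0 : ℝ)..t, (g (z τ) - w τ)

namespace IsDampedPath

variable {g : ℝ → ℝ} {M : ℝ} {z w : ℝ → ℝ}

lemma continuousOn_uIcc (h : IsDampedPath g M z w) {r t : ℝ} (hr : 0 ≤ r) (ht : 0 ≤ t) :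
    ContinuousOn z (Set.uIcc r t) :=
  h.continuousOn.mono fun _ hx => (le_min hr ht).trans hx.1

lemma bound_nonneg (h : IsDampedPath g M z w) : 0 ≤ M := by
  have h1 : ∃ᵐ t : ℝ, 0 ≤ t := by
    rw [frequently_ae_iff]
    have : {t : ℝ | 0 ≤ t} = Set.Ici 0 := rfl
    simp [this]
  obtain ⟨t, ht, hb⟩ := (h1.and_eventually h.ae_bound).exists
  exact (abs_nonneg _).trans (hb ht)

lemma intervalIntegrable' (h : IsDampedPath g M z w) {r t : ℝ} (hr : 0 ≤ r) (ht : 0 ≤ t) :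
    IntervalIntegrable w volume r t :=
  (h.intervalIntegrable r hr).symm.trans (h.intervalIntegrable t ht)

lemma intervalIntegrable_feedback (hg : IsDamping g) (h : IsDampedPath g M z w) {r t : ℝ}
    (hr : 0 ≤ r) (ht : 0 ≤ t) : IntervalIntegrable (fun τ => z τ * g (z τ)) volume r t :=
  ((h.continuousOn_uIcc hr ht).mul
    (hg.continuous.comp_continuousOn (h.continuousOn_uIcc hr ht))).intervalIntegrable

lemma intervalIntegrable_dissipation (hg : IsDamping g) (h : IsDampedPath g M z w) {r t : ℝ}
    (hr : 0 ≤ r) (ht : 0 ≤ t) : IntervalIntegrable (fun τ => -(z τ * g (z τ))) volume r t :=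
  (h.intervalIntegrable_feedback hg hr ht).neg

lemma intervalIntegrable_disturbance (h : IsDampedPath g M z w) {r t : ℝ}
    (hr : 0 ≤ r) (ht : 0 ≤ t) : IntervalIntegrable (fun τ => z τ * w τ) volume r t :=
  (h.intervalIntegrable' hr ht).continuousOn_mul (h.continuousOn_uIcc hr ht)

/-- The energy balance of a damped path. -/
lemma sq_sub_sq (hg : IsDamping g) (h : IsDampedPath g M z w) {r t : ℝ}
    (hr : 0 ≤ r) (ht : 0 ≤ t) :
    z t ^ 2 - z r ^ 2 =
      2 * ((∫ τ in r..t, z τ * g (z τ)) - ∫ τ in r..t, z τ * w τ) := by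
  have hint : ∀ a b : ℝ, 0 ≤ a → 0 ≤ b →
      IntervalIntegrable (fun τ => g (z τ) - w τ) volume a b := fun a b ha hb =>
    (hg.continuous.comp_continuousOn (h.continuousOn_uIcc ha hb)).intervalIntegrable.sub
      (h.intervalIntegrable' ha hb)
  -- The disturbance is merely integrable in time, so z is absolutely continuous but need not be
  -- differentiable everywhere. `Z` is a primitive agreeing with z on [0, ∞), to which the product
  -- rule for absolutely continuous functions applies.
  set Z : ℝ → ℝ := fun s => z r + ∫ τ in r..s, (g (z τ) - w τ) with hZ
  have hZz : ∀ s, 0 ≤ s → Z s = z s := fun s hs => by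
    have h1 := intervalIntegral.integral_interval_sub_left (hint 0 s le_rfl hs)
      (hint 0 r le_rfl hr)
    simp only [hZ]
    rw [h.eq_integral s hs, h.eq_integral r hr, ← h1]; ring
  have hconst : AbsolutelyContinuousOnInterval (fun _ : ℝ => z r) r t :=
    (LipschitzWith.const (z r)).lipschitzOnWith.absolutelyContinuousOnInterval
  have hAC : AbsolutelyContinuousOnInterval Z r t :=
    hconst.add ((hint r t hr ht).absolutelyContinuousOnInterval_intervalIntegral (by simp))
  have hmain := AbsolutelyContinuousOnInterval.integral_deriv_mul_eq_sub hAC hAC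
  rw [hZz t ht, hZz r hr] at hmain
  rw [← intervalIntegral.integral_sub (h.intervalIntegrable_feedback hg hr ht)
    (h.intervalIntegrable_disturbance hr ht), ← intervalIntegral.integral_const_mul, sq, sq,
    ← hmain]
  refine intervalIntegral.integral_congr_ae ?_
  filter_upwards [(hint r t hr ht).ae_hasDerivAt_integral] with s hs hmem
  have hmem' := Set.uIoc_subset_uIcc hmem
  have h0 : 0 ≤ s := (le_min hr ht).trans hmem'.1
  have hd : deriv Z s = g (z s) - w s := ((hs hmem' r (by simp)).const_add (z r)).deriv
  rw [hd, hZz s h0]; ring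

/-- The modulus of a damped path grows at most at rate `2 M`. -/
lemma abs_le_add (hg : IsDamping g) (h : IsDampedPath g M z w) {r t : ℝ}
    (hr : 0 ≤ r) (hrt : r ≤ t) : |z t| ≤ |z r| + 2 * M * (t - r) := by
  have ht := hr.trans hrt
  have hM := h.bound_nonneg
  -- At the point p where |z| is largest on [r, t], the work of the disturbance is at most |z p| M
  -- (p - r), and the feedback only lowers the energy.
  obtain ⟨p, hp, hmax⟩ := isCompact_Icc.exists_isMaxOn (Set.nonempty_Icc.2 hrt)
    ((h.continuousOn_uIcc hr ht).abs.mono Set.Icc_subset_uIcc)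
  have hp0 : 0 ≤ p := hr.trans hp.1
  refine (hmax (Set.right_mem_Icc.2 hrt)).trans ?_
  show |z p| ≤ _
  have h1 := h.sq_sub_sq hg hr hp0
  have h2 : ∫ τ in r..p, z τ * g (z τ) ≤ 0 := by
    have := intervalIntegral.integral_nonneg hp.1 (μ := volume)
      (f := fun τ => -(z τ * g (z τ))) fun τ _ => by have := hg.mul_nonpos (z τ); linarith
    rw [intervalIntegral.integral_neg] at this
    linarith
  have h3 : |∫ τ in r..p, z τ * w τ| ≤ |z p| * M * |p - r| := by
    rw [← Real.norm_eq_abs (∫ τ in r..p, z τ * w τ)]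
    refine intervalIntegral.norm_integral_le_of_norm_le_const_ae ?_
    filter_upwards [h.ae_bound] with τ hτ hmem
    rw [Set.uIoc_of_le hp.1] at hmem
    rw [Real.norm_eq_abs, abs_mul]
    exact mul_le_mul (hmax ⟨hmem.1.le, hmem.2.trans hp.2⟩) (hτ (hr.trans hmem.1.le))
      (abs_nonneg _) (abs_nonneg _)
  rw [abs_of_nonneg (sub_nonneg.2 hp.1)] at h3
  have h4 : |z p| ^ 2 ≤ |z r| ^ 2 + 2 * (|z p| * M * (p - r)) := by
    rw [sq_abs, sq_abs]; linarith [neg_le_of_abs_le h3]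
  have h5 : |z p| ≤ |z r| + 2 * M * (p - r) := by
    -- From m² ≤ b² + 2mM(p - r) with m = |z p| and b = |z r|: if m exceeded b + 2M(p - r),
    -- multiplying by m ≥ b would contradict this. The factor 2 comes from the square.
    by_contra! hlt
    have a1 := abs_nonneg (z r)
    have a2 : 0 ≤ M * (p - r) := mul_nonneg hM (sub_nonneg.2 hp.1)
    nlinarith
  have h6 : M * (p - r) ≤ M * (t - r) := mul_le_mul_of_nonneg_left (by linarith [hp.2]) hM
  linarith

/-- The energy dissipated along a path is nondecreasing in time. -/
lemma dissipation_mono (hg : IsDamping g) (h : IsDampedPath g M z w) {r t : ℝ}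
    (hr : 0 ≤ r) (hrt : r ≤ t) :
    ∫ τ in (0 : ℝ)..r, -(z τ * g (z τ)) ≤ ∫ τ in (0 : ℝ)..t, -(z τ * g (z τ)) := by
  rw [← sub_nonneg, intervalIntegral.integral_interval_sub_left
    (h.intervalIntegrable_dissipation hg le_rfl (hr.trans hrt))
    (h.intervalIntegrable_dissipation hg le_rfl hr)]
  exact intervalIntegral.integral_nonneg hrt fun τ _ => by
    have := hg.mul_nonpos (z τ); linarith

/-- A path that dissipates finitely much energy converges to the origin. -/
lemma tendsto_zero (hg : IsDamping g) (hs : IsStrictDamping g) (h : IsDampedPath g M z w)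
    {K : ℝ} (hK : ∀ N : ℕ, ∫ τ in (0 : ℝ)..N, -(z τ * g (z τ)) ≤ K) :
    Tendsto z atTop (𝓝 0) := by
  have hM := h.bound_nonneg
  -- Clamping time at zero makes the dissipated energy monotone on the whole line; being bounded, it
  -- converges.
  set Φ : ℝ → ℝ := fun t => ∫ τ in (0 : ℝ)..(max t 0), -(z τ * g (z τ)) with hΦ
  have hmono : Monotone Φ := fun r t hrt =>
    h.dissipation_mono hg (le_max_right _ _) (max_le_max_right _ hrt)
  have hbdd : BddAbove (Set.range Φ) := by
    refine ⟨K, ?_⟩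
    rintro _ ⟨t, rfl⟩
    obtain ⟨N, hN⟩ := exists_nat_ge (max t 0)
    exact (h.dissipation_mono hg (le_max_right _ _) hN).trans (hK N)
  have hlim := tendsto_atTop_ciSup hmono hbdd
  rw [Metric.tendsto_atTop]
  intro δ hδ
  obtain ⟨c, hc, hcle⟩ := hs (δ / 2) (by positivity)
  -- The growth rate 2M allows |z| to change from below δ/2 to δ only over a time longer than `l`; M
  -- + 1 avoids division by zero.
  set l := δ / (4 * (M + 1)) with hl
  have hlpos : 0 < l := by positivity
  have hMl : 2 * M * l ≤ δ / 2 := by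
    rw [hl, mul_div_assoc', div_le_div_iff₀ (by positivity) (by positivity)]; nlinarith
  have hdiff : Tendsto (fun t => Φ t - Φ (t - l)) atTop (𝓝 0) := by
    have := hlim.sub (hlim.comp (tendsto_atTop_add_const_right atTop (-l) tendsto_id))
    simpa [Function.comp_def, sub_eq_add_neg] using this
  have hev := (hdiff.eventually (gt_mem_nhds (mul_pos hlpos hc))).and (eventually_ge_atTop l)
  obtain ⟨T, hT⟩ := eventually_atTop.1 hev
  refine ⟨T, fun t ht => ?_⟩
  obtain ⟨h1, hlt⟩ := hT t ht
  rw [Real.dist_eq, sub_zero]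
  by_contra! hbig
  have hr : 0 ≤ t - l := by linarith
  have ht0 : 0 ≤ t := by linarith
  have h2 : Φ t - Φ (t - l) = ∫ τ in (t - l)..t, -(z τ * g (z τ)) := by
    simp only [hΦ, max_eq_left hr, max_eq_left ht0]
    exact intervalIntegral.integral_interval_sub_left
      (h.intervalIntegrable_dissipation hg le_rfl ht0)
      (h.intervalIntegrable_dissipation hg le_rfl hr)
  -- If |z t| ≥ δ, then |z| ≥ δ/2 throughout [t - l, t], so at least l c is dissipated there, while
  -- that amount tends to zero.
  have h3 : ∫ _ in (t - l)..t, c ≤ ∫ τ in (t - l)..t, -(z τ * g (z τ)) := by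
    refine intervalIntegral.integral_mono_on (by linarith) (by simp)
      (h.intervalIntegrable_dissipation hg hr ht0) fun τ hτ => hcle _ ?_
    have h4 := h.abs_le_add hg (hr.trans hτ.1) hτ.2
    have h5 : M * (t - τ) ≤ M * l := mul_le_mul_of_nonneg_left (by linarith [hτ.1]) hM
    linarith
  rw [intervalIntegral.integral_const, smul_eq_mul, sub_sub_cancel] at h3
  linarith

end IsDampedPath

/-! ### Expected energy and almost sure convergence -/

/-- A square integrable process whose paths are damped and whose value at each time is
uncorrelated with the bounded disturbance. -/
structure IsDampedProcess {Ω : Type*} [MeasurableSpace Ω] (μ : Measure Ω) (g : ℝ → ℝ) (M : ℝ)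
    (Z W : ℝ → Ω → ℝ) : Prop where
  measurable_state : ∀ t, 0 ≤ t → Measurable (Z t)
  measurable_disturbance : Measurable fun p : ℝ × Ω => W p.1 p.2
  bound : ∀ t, 0 ≤ t → ∀ᵐ ω ∂μ, |W t ω| ≤ M
  path : ∀ᵐ ω ∂μ, IsDampedPath g M (fun t => Z t ω) (fun t => W t ω)
  memLp_zero : MemLp (Z 0) 2 μ
  uncorrelated : ∀ t, 0 ≤ t → ∫ ω, Z t ω * W t ω ∂μ = 0

/-- A state whose paths are damped stays square integrable. -/
lemma memLp_two_of_damped {Ω : Type*} [MeasurableSpace Ω] {μ : Measure Ω} [IsFiniteMeasure μ]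
    {g : ℝ → ℝ} (hg : IsDamping g) {M : ℝ} {Z W : ℝ → Ω → ℝ}
    (hZ : ∀ t, 0 ≤ t → Measurable (Z t))
    (hpath : ∀ᵐ ω ∂μ, IsDampedPath g M (fun t => Z t ω) (fun t => W t ω))
    (h0 : MemLp (Z 0) 2 μ) {t : ℝ} (ht : 0 ≤ t) : MemLp (Z t) 2 μ := by
  refine (h0.norm.add (memLp_const (2 * M * t))).mono (hZ t ht).aestronglyMeasurable ?_
  filter_upwards [hpath] with ω hω
  have h1 := hω.abs_le_add hg le_rfl ht
  rw [sub_zero] at h1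
  exact h1.trans (le_abs_self _)

namespace IsDampedProcess

variable {Ω : Type*} [MeasurableSpace Ω] {μ : Measure Ω} [IsFiniteMeasure μ]
  {g : ℝ → ℝ} {M : ℝ} {Z W : ℝ → Ω → ℝ}

lemma memLp (hg : IsDamping g) (h : IsDampedProcess μ g M Z W) {t : ℝ} (ht : 0 ≤ t) :
    MemLp (Z t) 2 μ :=
  memLp_two_of_damped hg h.measurable_state h.path h.memLp_zero ht

/-- The work done by the disturbance is integrable and has mean zero. -/
lemma integral_work (hg : IsDamping g) (h : IsDampedProcess μ g M Z W) {T : ℝ} (hT : 0 ≤ T) :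
    Integrable (fun ω => ∫ τ in (0 : ℝ)..T, Z τ ω * W τ ω) μ ∧
      ∫ ω, (∫ τ in (0 : ℝ)..T, Z τ ω * W τ ω) ∂μ = 0 := by
  obtain ⟨G, hGsub, hGm, hGnull⟩ := exists_measurable_superset_of_null (ae_iff.1 h.path)
  have hG : ∀ᵐ ω ∂μ, ω ∉ G := by simpa [ae_iff] using hGnull
  have hgood : ∀ ω, ω ∉ G → IsDampedPath g M (fun t => Z t ω) (fun t => W t ω) := fun ω hω => by
    by_contra hn; exact hω (hGsub hn)
  -- Fubini needs joint measurability. `Y` vanishes on a measurable null set containing the bad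
  -- outcomes and is constant for negative times, so all its paths are continuous and each `Y t` is
  -- measurable; this makes it jointly measurable.
  set Y : ℝ → Ω → ℝ := fun t => Gᶜ.indicator (Z (max t 0)) with hY
  have hYm : Measurable (Function.uncurry Y) := by
    refine measurable_uncurry_of_continuous_of_measurable (fun ω => ?_) fun t =>
      (h.measurable_state _ (le_max_right _ _)).indicator hGm.compl
    by_cases hω : ω ∈ G
    · simp [hY, hω, continuous_const]
    · have h1 := (hgood ω hω).continuousOn.comp_continuous (f := fun t : ℝ => max t 0)
        (by fun_prop) fun t => Set.mem_Ici.2 (le_max_right t 0)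
      simpa [hY, hω, Function.comp_def] using h1
  have hYZ : ∀ t, 0 ≤ t → ∀ᵐ ω ∂μ, Y t ω = Z t ω := fun t ht => by
    filter_upwards [hG] with ω hω
    simp [hY, hω, max_eq_left ht]
  -- The absolute value of `M` is used because the sign of `M` is known only on good outcomes, and
  -- there are none if μ = 0.
  have hYb : ∀ t, 0 ≤ t → t ≤ T → ∀ᵐ ω ∂μ, |Y t ω| ≤ |Z 0 ω| + 2 * |M| * T := by
    intro t ht htT
    filter_upwards [hYZ t ht, h.path] with ω h1 h2
    rw [h1]
    have h3 := h2.abs_le_add hg le_rfl ht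
    have h4 := h2.bound_nonneg
    rw [abs_of_nonneg h4]
    nlinarith
  have hint : Integrable (Function.uncurry fun t ω => Y t ω * W t ω)
      ((volume.restrict (Set.uIoc 0 T)).prod μ) := by
    have hZ0 : Integrable (Z 0) μ := h.memLp_zero.integrable (by norm_num)
    have : IsFiniteMeasure (volume.restrict (Set.uIoc 0 T)) :=
      ⟨by simp [Set.uIoc_of_le hT]⟩
    have hdom : Integrable (fun p : ℝ × Ω => (|Z 0 p.2| + 2 * |M| * T) * |M|)
        ((volume.restrict (Set.uIoc 0 T)).prod μ) :=
      Integrable.comp_snd (f := fun ω => (|Z 0 ω| + 2 * |M| * T) * |M|)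
        ((hZ0.abs.add (integrable_const _)).mul_const _) _
    have hprod : Measurable (Function.uncurry fun t ω => Y t ω * W t ω) :=
      hYm.mul h.measurable_disturbance
    refine hdom.mono' hprod.aestronglyMeasurable ?_
    have hset : MeasurableSet {p : ℝ × Ω | ‖Function.uncurry (fun t ω => Y t ω * W t ω) p‖ ≤
        (|Z 0 p.2| + 2 * |M| * T) * |M|} := by
      refine measurableSet_le hprod.norm ?_
      have : Measurable fun p : ℝ × Ω => Z 0 p.2 :=
        (h.measurable_state 0 le_rfl).comp measurable_snd
      exact ((measurable_norm.comp this).add_const _).mul_const _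
    rw [Measure.ae_prod_iff_ae_ae hset, ae_restrict_iff' measurableSet_uIoc]
    refine ae_of_all _ fun t ht => ?_
    rw [Set.uIoc_of_le hT] at ht
    filter_upwards [hYb t ht.1.le ht.2, h.bound t ht.1.le] with ω h1 h2
    simp only [Function.uncurry, norm_mul, Real.norm_eq_abs]
    exact mul_le_mul h1 (h2.trans (le_abs_self _)) (abs_nonneg _) ((abs_nonneg _).trans h1)
  have hcongr : (fun ω => ∫ τ in (0 : ℝ)..T, Y τ ω * W τ ω) =ᵐ[μ]
      fun ω => ∫ τ in (0 : ℝ)..T, Z τ ω * W τ ω := by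
    filter_upwards [hG] with ω hω
    refine intervalIntegral.integral_congr fun τ hτ => ?_
    rw [Set.uIcc_of_le hT] at hτ
    simp [hY, hω, max_eq_left hτ.1]
  refine ⟨Integrable.congr ?_ hcongr, ?_⟩
  · have := hint.integral_prod_right
    refine this.congr (ae_of_all _ fun ω => ?_)
    show _ = ∫ τ in (0 : ℝ)..T, Y τ ω * W τ ω
    rw [intervalIntegral.integral_of_le hT, ← Set.uIoc_of_le hT]
    rfl
  · rw [← integral_congr_ae hcongr, ← intervalIntegral_integral_swap hint,
      intervalIntegral.integral_congr (g := fun _ => 0), intervalIntegral.integral_zero]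
    intro t ht
    rw [Set.uIcc_of_le hT] at ht
    show ∫ ω, Y t ω * W t ω ∂μ = 0
    rw [← h.uncorrelated t ht.1]
    refine integral_congr_ae ?_
    filter_upwards [hYZ t ht.1] with ω hω
    rw [hω]

/-- The expected energy balance. -/
lemma integral_energy (hg : IsDamping g) (h : IsDampedProcess μ g M Z W) {T : ℝ} (hT : 0 ≤ T) :
    Integrable (fun ω => ∫ τ in (0 : ℝ)..T, -(Z τ ω * g (Z τ ω))) μ ∧
      (∫ ω, Z T ω ^ 2 ∂μ) + 2 * ∫ ω, (∫ τ in (0 : ℝ)..T, -(Z τ ω * g (Z τ ω))) ∂μ =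
        ∫ ω, Z 0 ω ^ 2 ∂μ := by
  obtain ⟨hwi, hw0⟩ := h.integral_work hg hT
  have hT2 := (h.memLp hg hT).integrable_sq
  have h02 := h.memLp_zero.integrable_sq
  have heq : (fun ω => ∫ τ in (0 : ℝ)..T, -(Z τ ω * g (Z τ ω))) =ᵐ[μ] fun ω =>
      (Z 0 ω ^ 2 - Z T ω ^ 2) / 2 - ∫ τ in (0 : ℝ)..T, Z τ ω * W τ ω := by
    filter_upwards [h.path] with ω hω
    have := hω.sq_sub_sq hg le_rfl hT
    rw [intervalIntegral.integral_neg]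
    linarith
  have hsub : Integrable (fun ω => (Z 0 ω ^ 2 - Z T ω ^ 2) / 2) μ := (h02.sub hT2).div_const 2
  refine ⟨(hsub.sub hwi).congr heq.symm, ?_⟩
  rw [integral_congr_ae heq, integral_sub hsub hwi, hw0, integral_div, integral_sub h02 hT2]
  ring

/-- A damped process that starts at the origin stays there. -/
lemma eq_zero_of_zero (hg : IsDamping g) (h : IsDampedProcess μ g M Z W)
    (h0 : ∀ᵐ ω ∂μ, Z 0 ω = 0) : ∀ᵐ ω ∂μ, ∀ t, 0 ≤ t → Z t ω = 0 := by
  have hfix : ∀ t, 0 ≤ t → ∀ᵐ ω ∂μ, Z t ω = 0 := by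
    intro t ht
    obtain ⟨-, he⟩ := h.integral_energy hg ht
    have h1 : ∫ ω, Z 0 ω ^ 2 ∂μ = 0 := by
      rw [integral_congr_ae (g := fun _ => (0 : ℝ)), integral_zero]
      filter_upwards [h0] with ω hω
      simp [hω]
    have h2 : 0 ≤ ∫ ω, (∫ τ in (0 : ℝ)..t, -(Z τ ω * g (Z τ ω))) ∂μ :=
      integral_nonneg fun ω => intervalIntegral.integral_nonneg ht fun τ _ => by
        have := hg.mul_nonpos (Z τ ω); linarith
    have h3 : 0 ≤ ∫ ω, Z t ω ^ 2 ∂μ := integral_nonneg fun ω => sq_nonneg _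
    have h4 : ∫ ω, Z t ω ^ 2 ∂μ = 0 := by linarith
    rw [integral_eq_zero_iff_of_nonneg (fun ω => sq_nonneg _)
      (h.memLp hg ht).integrable_sq] at h4
    filter_upwards [h4] with ω hω
    simpa using hω
  -- A single null set serves all rational times; the growth bound, started from a rational just
  -- before t, then reaches every real t.
  have hrat : ∀ᵐ ω ∂μ, ∀ q : ℚ, (0 : ℝ) ≤ q → Z q ω = 0 := ae_all_iff.2 fun q => by
    by_cases hq : (0 : ℝ) ≤ q
    · filter_upwards [hfix q hq] with ω hω _ using hω
    · exact ae_of_all _ fun ω h => absurd h hq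
  filter_upwards [hrat, h0, h.path] with ω hq h0ω hω t ht
  rcases ht.eq_or_lt with rfl | htpos
  · exact h0ω
  have hM := hω.bound_nonneg
  refine abs_nonpos_iff.1 (le_of_forall_pos_le_add fun e he => ?_)
  obtain ⟨q, hq1, hq2⟩ := exists_rat_btwn
    (max_lt htpos (sub_lt_self t (div_pos he (by positivity : 0 < 2 * M + 1))))
  obtain ⟨hq0, hqe⟩ := max_lt_iff.1 hq1
  have h1 := hω.abs_le_add hg hq0.le hq2.le
  rw [hq q hq0.le, abs_zero] at h1
  have h2 : 2 * M * (t - q) ≤ e := by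
    have h3 : t - q ≤ e / (2 * M + 1) := by linarith
    rw [le_div_iff₀ (by positivity)] at h3
    nlinarith
  linarith

/-- A strictly damped process converges to the origin almost surely. -/
lemma tendsto_zero (hg : IsDamping g) (hs : IsStrictDamping g) (h : IsDampedProcess μ g M Z W) :
    ∀ᵐ ω ∂μ, Tendsto (fun t => Z t ω) atTop (𝓝 0) := by
  set Φ : ℕ → Ω → ℝ := fun N ω => ∫ τ in (0 : ℝ)..N, -(Z τ ω * g (Z τ ω)) with hΦ
  have hpos : ∀ N ω, 0 ≤ Φ N ω := fun N ω =>
    intervalIntegral.integral_nonneg N.cast_nonneg fun τ _ => by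
      have := hg.mul_nonpos (Z τ ω); linarith
  have hint : ∀ N, Integrable (Φ N) μ := fun N => (h.integral_energy hg N.cast_nonneg).1
  have hle : ∀ N, ∫ ω, Φ N ω ∂μ ≤ ∫ ω, Z 0 ω ^ 2 ∂μ := fun N => by
    have h1 := (h.integral_energy hg (N.cast_nonneg (α := ℝ))).2
    have h2 : 0 ≤ ∫ ω, Z N ω ^ 2 ∂μ := integral_nonneg fun ω => sq_nonneg _
    have h3 : 0 ≤ ∫ ω, Φ N ω ∂μ := integral_nonneg (hpos N)
    simp only [hΦ] at h3 ⊢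
    linarith
  have hmeas : ∀ N, AEMeasurable (fun ω => ENNReal.ofReal (Φ N ω)) μ := fun N =>
    (hint N).aestronglyMeasurable.aemeasurable.ennreal_ofReal
  have hmono : ∀ᵐ ω ∂μ, Monotone fun N => ENNReal.ofReal (Φ N ω) := by
    filter_upwards [h.path] with ω hω N K hNK
    exact ENNReal.ofReal_le_ofReal
      (hω.dissipation_mono hg N.cast_nonneg (Nat.cast_le.2 hNK))
  -- Monotone convergence: the expected total dissipation is at most E z(0)², so the total is finite
  -- almost surely. Integer times suffice by monotonicity.
  have hsup : ∫⁻ ω, ⨆ N, ENNReal.ofReal (Φ N ω) ∂μ ≠ ⊤ := by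
    rw [lintegral_iSup' hmeas hmono]
    refine ne_top_of_le_ne_top (ENNReal.ofReal_ne_top (r := ∫ ω, Z 0 ω ^ 2 ∂μ))
      (iSup_le fun N => ?_)
    rw [← ofReal_integral_eq_lintegral_ofReal (hint N) (ae_of_all _ (hpos N))]
    exact ENNReal.ofReal_le_ofReal (hle N)
  filter_upwards [h.path, ae_lt_top' (AEMeasurable.iSup hmeas) hsup] with ω hω hfin
  refine hω.tendsto_zero hg hs (K := (⨆ N, ENNReal.ofReal (Φ N ω)).toReal) fun N => ?_
  exact (ENNReal.ofReal_le_iff_le_toReal hfin.ne).1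
    (le_iSup (fun N => ENNReal.ofReal (Φ N ω)) N)

end IsDampedProcess

/-! ### Linear algebra of the flow matrix -/

lemma card_properCoalition_add_one {n : ℕ} (hn : 0 < n) :
    Fintype.card (ProperCoalition n) + 1 = Fintype.card (Coalition n) := by
  have : Nonempty (Fin n) := ⟨⟨0, hn⟩⟩
  rw [Fintype.card_subtype, Fintype.card_subtype]
  have h1 : (Finset.univ.filter fun S : Finset (Fin n) => S.Nonempty ∧ S ≠ Finset.univ) =
      (Finset.univ.filter fun S : Finset (Fin n) => S.Nonempty).erase Finset.univ := by
    ext S; simp [and_comm]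
  rw [h1]
  exact Finset.card_erase_add_one (by simp [Finset.univ_nonempty])

section LinearAlgebra

variable {n : ℕ} {C : Matrix (Fin (n - 1)) (ControlIdx n) ℝ}
  {Bd : Matrix (ControlIdx n) (Coalition n) ℝ} {F : Matrix (ControlIdx n) (Fin (n - 1)) ℝ}

/-- The stacked matrices are square by counting coalitions, so a one-sided inverse is two-sided.
This is what decouples the coordinates of z. -/
lemma leftInverse_of_inverse (hn : 0 < n)
    (hinv : Matrix.fromRows (flowMatrix n) C * Matrix.fromCols Bd F = 1) :
    Bd * flowMatrix n + F * C = 1 := by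
  have hcard : Fintype.card (Coalition n ⊕ Fin (n - 1)) = Fintype.card (ControlIdx n) := by
    rw [Fintype.card_sum, Fintype.card_sum, Fintype.card_fin, Fintype.card_fin,
      ← card_properCoalition_add_one hn]
    omega
  rw [← Matrix.fromCols_mul_fromRows]
  exact (Matrix.mul_eq_one_comm_of_equiv (Fintype.card_eq.1 hcard).some).1 hinv

lemma rightInverse_of_inverse
    (hinv : Matrix.fromRows (flowMatrix n) C * Matrix.fromCols Bd F = 1) :
    flowMatrix n * Bd = 1 ∧ flowMatrix n * F = 0 ∧ C * Bd = 0 ∧ C * F = 1 := by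
  rwa [Matrix.fromRows_mul_fromCols, ← Matrix.fromBlocks_one, Matrix.fromBlocks_inj] at hinv

lemma flowMatrix_mulVec_zState
    (hinv : Matrix.fromRows (flowMatrix n) C * Matrix.fromCols Bd F = 1)
    (x : Coalition n → ℝ) (y : Fin (n - 1) → ℝ) :
    (flowMatrix n).mulVec (zState Bd F x y) = x := by
  obtain ⟨h1, h2, -, -⟩ := rightInverse_of_inverse hinv
  simp [zState, Matrix.mulVec_add, Matrix.mulVec_mulVec, h1, h2]

lemma mulVec_zState
    (hinv : Matrix.fromRows (flowMatrix n) C * Matrix.fromCols Bd F = 1)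
    (x : Coalition n → ℝ) (y : Fin (n - 1) → ℝ) :
    C.mulVec (zState Bd F x y) = y := by
  obtain ⟨-, -, h1, h2⟩ := rightInverse_of_inverse hinv
  simp [zState, Matrix.mulVec_add, Matrix.mulVec_mulVec, h1, h2]

lemma zState_drift (hn : 0 < n)
    (hinv : Matrix.fromRows (flowMatrix n) C * Matrix.fromCols Bd F = 1)
    (d : ControlIdx n → ℝ) (w : Coalition n → ℝ) :
    zState Bd F ((flowMatrix n).mulVec d - w) (C.mulVec d) = d - Bd.mulVec w := by
  have h := congrArg (fun A => A.mulVec d) (leftInverse_of_inverse hn hinv)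
  simp only [Matrix.add_mulVec, ← Matrix.mulVec_mulVec, Matrix.one_mulVec] at h
  rw [zState, Matrix.mulVec_sub, sub_add_eq_add_sub, h]

lemma flowMatrix_mulVec_apply (u : ControlIdx n → ℝ) (S : Coalition n) :
    (flowMatrix n).mulVec u S =
      (∑ i ∈ S.1, u (Sum.inl i)) - extendSurplus (fun T => u (Sum.inr T)) S := by
  rw [flowMatrix, Matrix.fromCols_mulVec, Pi.add_apply, sub_eq_add_neg]
  congr 1
  · simp [Matrix.mulVec, dotProduct, incidence, Finset.sum_ite_mem]
  · by_cases h : S.1 = Finset.univ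
    · rw [extendSurplus, dif_pos h, neg_zero, Matrix.mulVec, dotProduct]
      refine Finset.sum_eq_zero fun T _ => ?_
      have : S.1 ≠ T.1 := fun hST => T.2.2 (hST ▸ h)
      simp [surplusBlock, this]
    · rw [extendSurplus, dif_neg h, Matrix.mulVec, dotProduct,
        Finset.sum_eq_single ⟨S.1, S.2, h⟩]
      · simp [surplusBlock]
      · intro T _ hT
        have : S.1 ≠ T.1 := fun hST => hT (Subtype.ext hST.symm)
        simp [surplusBlock, this]
      · simp

lemma continuous_extendSurplus : Continuous (extendSurplus (n := n)) :=
  continuous_pi fun S => by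
    by_cases h : S.1 = Finset.univ
    · simp [extendSurplus, h, continuous_const]
    · simpa [extendSurplus, h] using continuous_apply _

lemma extendSurplus_smul (c : ℝ) (s : ProperCoalition n → ℝ) :
    extendSurplus (c • s) = c • extendSurplus s := by
  ext S
  by_cases h : S.1 = Finset.univ <;> simp [extendSurplus, h]

end LinearAlgebra

/-! ### The saturated controller, coordinate by coordinate -/

section Feedback

variable {n : ℕ} {aMin aMax : Fin n → ℝ} {uNom : ControlIdx n → ℝ}

/-- The scalar feedback law acting on one coordinate of the state `z`. -/
noncomputable def feedback (aMin aMax : Fin n → ℝ) (uNom : ControlIdx n → ℝ)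
    (j : ControlIdx n) (ξ : ℝ) : ℝ :=
  sat (duMin aMin uNom j) (duMax aMax uNom j) (-ξ)

lemma isDamping_feedback (hfeas : uNom ∈ feasible aMin aMax) (j : ControlIdx n) :
    IsDamping (feedback aMin aMax uNom j) := by
  cases j with
  | inl i => exact isDamping_sat_coe (by linarith [hfeas.1 i]) (by linarith [hfeas.1 i])
  | inr S => exact isDamping_sat_top (by linarith [hfeas.2 S])

lemma isStrictDamping_feedback
    (ha : ∀ i, aMin i < uNom (Sum.inl i) ∧ uNom (Sum.inl i) < aMax i)
    (hs : ∀ S, 0 < uNom (Sum.inr S)) (j : ControlIdx n) :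
    IsStrictDamping (feedback aMin aMax uNom j) := by
  cases j with
  | inl i => exact isStrictDamping_sat_coe (by linarith [ha i]) (by linarith [ha i])
  | inr S => exact isStrictDamping_sat_top (by linarith [hs S])

lemma controller_mem_feasible (hfeas : uNom ∈ feasible aMin aMax) (z : ControlIdx n → ℝ) :
    controller aMin aMax uNom z ∈ feasible aMin aMax := by
  refine ⟨fun i => ?_, fun S => ?_⟩
  · have h := hfeas.1 i
    show aMin i ≤ uNom (Sum.inl i) +
        sat (aMin i - uNom (Sum.inl i) : ℝ) (aMax i - uNom (Sum.inl i) : ℝ) (-z (Sum.inl i)) ∧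
      uNom (Sum.inl i) +
        sat (aMin i - uNom (Sum.inl i) : ℝ) (aMax i - uNom (Sum.inl i) : ℝ) (-z (Sum.inl i)) ≤
        aMax i
    rw [sat_coe_coe (by linarith)]
    grind
  · show 0 ≤ uNom (Sum.inr S) + sat (-uNom (Sum.inr S) : ℝ) ⊤ (-z (Sum.inr S))
    rw [sat_coe_top]
    grind

lemma continuous_deviation (hfeas : uNom ∈ feasible aMin aMax) :
    Continuous (deviation aMin aMax uNom) :=
  continuous_pi fun j => (isDamping_feedback hfeas j).continuous.comp (continuous_apply j)

lemma continuous_controller (hfeas : uNom ∈ feasible aMin aMax) :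
    Continuous (controller aMin aMax uNom) :=
  continuous_const.add (continuous_deviation hfeas)

lemma controller_zero (hfeas : uNom ∈ feasible aMin aMax) :
    controller aMin aMax uNom 0 = uNom := by
  ext j
  have h := (isDamping_feedback hfeas j).abs_le 0
  rw [abs_zero, abs_nonpos_iff] at h
  show uNom j + feedback aMin aMax uNom j 0 = uNom j
  rw [h, add_zero]

end Feedback

/-! ### Time averages and bounded ergodic processes -/

/-- Cesàro's theorem for a path on `[0, ∞)`. -/
lemma tendsto_timeAvg {ι : Type*} [Fintype ι] {f : ℝ → ι → ℝ} {L : ι → ℝ}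
    (hf : ContinuousOn f (Set.Ici 0)) (hL : Tendsto f atTop (𝓝 L)) :
    Tendsto (timeAvg f) atTop (𝓝 L) := by
  have hint : ∀ a b : ℝ, 0 ≤ a → 0 ≤ b →
      IntervalIntegrable (fun τ => f τ - L) volume a b := fun a b ha hb =>
    ((hf.sub continuousOn_const).mono fun _ hx => (le_min ha hb).trans hx.1).intervalIntegrable
  rw [Metric.tendsto_atTop] at hL
  rw [Metric.tendsto_atTop]
  intro e he
  obtain ⟨T', hT'⟩ := hL (e / 2) (by positivity)
  set T := max T' 1
  have hT0 : 0 < T := lt_of_lt_of_le one_pos (le_max_right _ _)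
  set K := ‖∫ τ in (0 : ℝ)..T, (f τ - L)‖
  -- Beyond this time the initial segment contributes K < e t / 2, and the tail contributes at most
  -- e (t - T) / 2.
  refine ⟨max T (2 * K / e + 1), fun t ht => ?_⟩
  have hTt : T ≤ t := (le_max_left _ _).trans ht
  have ht0 : 0 < t := hT0.trans_le hTt
  have hKt : 2 * K / e < t := by linarith [(le_max_right T (2 * K / e + 1)).trans ht]
  rw [div_lt_iff₀ he] at hKt
  have h1 : timeAvg f t - L = t⁻¹ • ∫ τ in (0 : ℝ)..t, (f τ - L) := by
    have h2 : IntervalIntegrable f volume 0 t := by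
      simpa using (hint 0 t le_rfl ht0.le).add
        (intervalIntegrable_const (μ := volume) (c := L))
    rw [intervalIntegral.integral_sub h2 intervalIntegrable_const,
      intervalIntegral.integral_const, sub_zero, smul_sub, smul_smul, inv_mul_cancel₀ ht0.ne',
      one_smul, timeAvg]
  rw [dist_eq_norm, h1, norm_smul, norm_inv, Real.norm_of_nonneg ht0.le, inv_mul_lt_iff₀ ht0,
    ← intervalIntegral.integral_add_adjacent_intervals (hint 0 T le_rfl hT0.le)
      (hint T t hT0.le ht0.le)]
  have h3 : ‖∫ τ in T..t, (f τ - L)‖ ≤ e / 2 * |t - T| := by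
    refine intervalIntegral.norm_integral_le_of_norm_le_const fun τ hτ => ?_
    rw [Set.uIoc_of_le hTt] at hτ
    rw [← dist_eq_norm]
    exact (hT' τ ((le_max_left _ _).trans hτ.1.le)).le
  rw [abs_of_nonneg (sub_nonneg.2 hTt)] at h3
  refine (norm_add_le _ _).trans_lt ?_
  nlinarith

namespace IsBoundedMeanErgodic

variable {n : ℕ} {Ω : Type*} [MeasurableSpace Ω] {μ : Measure Ω}
    {V : Set (Coalition n → ℝ)} {P : Measure (Coalition n → ℝ)}
    {v : ℝ → Ω → Coalition n → ℝ} {vNom : Coalition n → ℝ}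

lemma measurable_at (hv : IsBoundedMeanErgodic μ V P v vNom) (t : ℝ) : Measurable (v t) :=
  hv.measurable.comp measurable_prodMk_left

lemma exists_bound (hv : IsBoundedMeanErgodic μ V P v vNom) :
    ∃ R, ∀ t, 0 ≤ t → ∀ᵐ ω ∂μ, ‖v t ω‖ ≤ R := by
  obtain ⟨R, hR⟩ := hv.bounded.exists_norm_le
  refine ⟨R, fun t ht => ?_⟩
  have h1 : ∀ᵐ w ∂(Measure.map (v t) μ), ‖w‖ ≤ R := by
    rw [hv.law t ht]
    filter_upwards [hv.carried] with w hw using hR w hw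
  exact ae_of_ae_map (hv.measurable_at t).aemeasurable h1

/-- Fubini for null sets: the bound holds almost surely at each time, hence almost surely at almost
every time. Joint measurability of v enters here. -/
lemma ae_path_bound [SFinite μ] (hv : IsBoundedMeanErgodic μ V P v vNom) {R : ℝ}
    (hR : ∀ t, 0 ≤ t → ∀ᵐ ω ∂μ, ‖v t ω‖ ≤ R) :
    ∀ᵐ ω ∂μ, ∀ᵐ t, 0 ≤ t → ‖v t ω‖ ≤ R := by
  have hset : MeasurableSet {p : ℝ × Ω | 0 ≤ p.1 → ‖v p.1 p.2‖ ≤ R} :=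
    (measurableSet_le measurable_const measurable_fst).imp
      (measurableSet_le hv.measurable.norm measurable_const)
  refine (Measure.ae_ae_comm (p := fun (t : ℝ) ω => 0 ≤ t → ‖v t ω‖ ≤ R) hset).1
    (ae_of_all _ fun t => ?_)
  by_cases ht : 0 ≤ t
  · filter_upwards [hR t ht] with ω hω _ using hω
  · exact ae_of_all _ fun ω h => absurd h ht

lemma intervalIntegrable (hv : IsBoundedMeanErgodic μ V P v vNom) {R : ℝ} {ω : Ω}
    (hR : ∀ᵐ t, 0 ≤ t → ‖v t ω‖ ≤ R) {t : ℝ} (ht : 0 ≤ t) :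
    IntervalIntegrable (fun τ => v τ ω) volume 0 t := by
  refine (intervalIntegrable_const (c := R)).mono_fun'
    (hv.measurable.comp measurable_prodMk_right).aestronglyMeasurable ?_
  rw [EventuallyLE, ae_restrict_iff' measurableSet_uIoc]
  filter_upwards [hR] with τ hτ hmem
  rw [Set.uIoc_of_le ht] at hmem
  exact hτ hmem.1.le

lemma integrable [IsFiniteMeasure μ] (hv : IsBoundedMeanErgodic μ V P v vNom) {t : ℝ}
    (ht : 0 ≤ t) : Integrable (v t) μ := by
  obtain ⟨R, hR⟩ := hv.exists_bound
  exact (integrable_const R).mono' (hv.measurable_at t).aestronglyMeasurable (hR t ht)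

end IsBoundedMeanErgodic

/-! ### The closed loop in decoupled coordinates -/

/-- The continuous linear map of a matrix. -/
noncomputable abbrev mulVecCLM {ι κ : Type*} [Fintype ι] [Fintype κ] (A : Matrix κ ι ℝ) :
    (ι → ℝ) →L[ℝ] (κ → ℝ) :=
  LinearMap.toContinuousLinearMap A.mulVecLin

lemma _root_.ContinuousLinearMap.intervalIntegrable_comp {E E' : Type*} [NormedAddCommGroup E]
    [NormedSpace ℝ E] [NormedAddCommGroup E'] [NormedSpace ℝ E'] (L : E →L[ℝ] E') {f : ℝ → E}
    {a b : ℝ} (hf : IntervalIntegrable f volume a b) :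
    IntervalIntegrable (fun t => L (f t)) volume a b :=
  ⟨L.integrable_comp hf.1, L.integrable_comp hf.2⟩

namespace IsClosedLoop

variable {n : ℕ} {Ω : Type*} [MeasurableSpace Ω] {μ : Measure Ω}
    {V : Set (Coalition n → ℝ)} {P : Measure (Coalition n → ℝ)}
    {v : ℝ → Ω → Coalition n → ℝ} {vNom : Coalition n → ℝ}
    {aMin aMax : Fin n → ℝ} {uNom : ControlIdx n → ℝ}
    {C : Matrix (Fin (n - 1)) (ControlIdx n) ℝ}
    {Bd : Matrix (ControlIdx n) (Coalition n) ℝ} {F : Matrix (ControlIdx n) (Fin (n - 1)) ℝ}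
    {x : ℝ → Ω → Coalition n → ℝ} {y : ℝ → Ω → Fin (n - 1) → ℝ}

lemma measurable_zState (hxy : IsClosedLoop μ aMin aMax uNom C Bd F v vNom x y)
    {t : ℝ} (ht : 0 ≤ t) : Measurable fun ω => zState Bd F (x t ω) (y t ω) :=
  ((mulVecCLM Bd).measurable.comp (hxy.measurable_x t ht)).add
    ((mulVecCLM F).measurable.comp (hxy.measurable_y t ht))

lemma continuousOn_zState (hxy : IsClosedLoop μ aMin aMax uNom C Bd F v vNom x y) :
    ∀ᵐ ω ∂μ, ContinuousOn (fun t => zState Bd F (x t ω) (y t ω)) (Set.Ici 0) := by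
  filter_upwards [hxy.continuous_paths] with ω hω
  exact ((mulVecCLM Bd).continuous.comp_continuousOn hω.1).add
    ((mulVecCLM F).continuous.comp_continuousOn hω.2)

/-- The closed loop decouples in the coordinates of `z`. -/
lemma zState_eq [SFinite μ] (hn : 0 < n) (hv : IsBoundedMeanErgodic μ V P v vNom)
    (hfeas : uNom ∈ feasible aMin aMax)
    (hinv : Matrix.fromRows (flowMatrix n) C * Matrix.fromCols Bd F = 1)
    (hxy : IsClosedLoop μ aMin aMax uNom C Bd F v vNom x y) :
    ∀ᵐ ω ∂μ, ∀ t, 0 ≤ t → zState Bd F (x t ω) (y t ω) = zState Bd F (x 0 ω) (y 0 ω) +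
      ∫ τ in (0 : ℝ)..t, (deviation aMin aMax uNom (zState Bd F (x τ ω) (y τ ω)) -
        Bd.mulVec (v τ ω - vNom)) := by
  obtain ⟨R, hR⟩ := hv.exists_bound
  filter_upwards [hxy.eq_x, hxy.eq_y, hxy.continuousOn_zState, hv.ae_path_bound hR]
    with ω hx hy hc hb t ht
  have hdev : IntervalIntegrable
      (fun τ => deviation aMin aMax uNom (zState Bd F (x τ ω) (y τ ω))) volume 0 t :=
    ((continuous_deviation hfeas).comp_continuousOn (hc.mono fun s hs => by
      rw [Set.uIcc_of_le ht] at hs; exact hs.1)).intervalIntegrable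
  have hfx : IntervalIntegrable (fun τ => (flowMatrix n).mulVec
      (deviation aMin aMax uNom (zState Bd F (x τ ω) (y τ ω))) - (v τ ω - vNom)) volume 0 t :=
    ((mulVecCLM (flowMatrix n)).intervalIntegrable_comp hdev).sub
      ((hv.intervalIntegrable hb ht).sub intervalIntegrable_const)
  have hfy : IntervalIntegrable (fun τ => C.mulVec
      (deviation aMin aMax uNom (zState Bd F (x τ ω) (y τ ω)))) volume 0 t :=
    (mulVecCLM C).intervalIntegrable_comp hdev
  -- The decoupled drift is written as the image of the pair of drifts of x and y under [B† F],
  -- which commutes with the integral.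
  simp_rw [← zState_drift hn hinv]
  have h1 := (mulVecCLM Bd).intervalIntegral_comp_comm hfx
  have h2 := (mulVecCLM F).intervalIntegral_comp_comm hfy
  have h3 := intervalIntegral.integral_add ((mulVecCLM Bd).intervalIntegrable_comp hfx)
    ((mulVecCLM F).intervalIntegrable_comp hfy)
  rw [h1, h2] at h3
  rw [hx t ht, hy t ht]
  refine Eq.trans ?_ (congrArg (zState Bd F (x 0 ω) (y 0 ω) + ·) h3.symm)
  simp only [zState, Matrix.mulVec_add, LinearMap.coe_toContinuousLinearMap',
    Matrix.mulVecLin_apply]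
  abel

lemma exists_isDampedPath [IsFiniteMeasure μ] (hn : 0 < n)
    (hv : IsBoundedMeanErgodic μ V P v vNom)
    (hfeas : uNom ∈ feasible aMin aMax)
    (hinv : Matrix.fromRows (flowMatrix n) C * Matrix.fromCols Bd F = 1)
    (hxy : IsClosedLoop μ aMin aMax uNom C Bd F v vNom x y) :
    ∃ M, (∀ j, ∀ t, 0 ≤ t → ∀ᵐ ω ∂μ, |Bd.mulVec (v t ω - vNom) j| ≤ M) ∧
      ∀ j, ∀ᵐ ω ∂μ, IsDampedPath (feedback aMin aMax uNom j) M
        (fun t => zState Bd F (x t ω) (y t ω) j) (fun t => Bd.mulVec (v t ω - vNom) j) := by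
  obtain ⟨R, hR⟩ := hv.exists_bound
  have hkey : ∀ j w, ‖w‖ ≤ R → |Bd.mulVec (w - vNom) j| ≤ ‖mulVecCLM Bd‖ * (R + ‖vNom‖) :=
    fun j w hw => calc
      |Bd.mulVec (w - vNom) j| ≤ ‖mulVecCLM Bd (w - vNom)‖ :=
        norm_le_pi_norm (mulVecCLM Bd (w - vNom)) j
      _ ≤ ‖mulVecCLM Bd‖ * ‖w - vNom‖ := (mulVecCLM Bd).le_opNorm _
      _ ≤ _ := by gcongr; exact (norm_sub_le _ _).trans (by gcongr)
  refine ⟨‖mulVecCLM Bd‖ * (R + ‖vNom‖), fun j t ht => ?_, fun j => ?_⟩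
  · filter_upwards [hR t ht] with ω hω using hkey j _ hω
  filter_upwards [hxy.zState_eq hn hv hfeas hinv, hxy.continuousOn_zState,
    hv.ae_path_bound hR] with ω hz hc hb
  have hw : ∀ t, 0 ≤ t → IntervalIntegrable (fun τ => Bd.mulVec (v τ ω - vNom)) volume 0 t :=
    fun t ht => (mulVecCLM Bd).intervalIntegrable_comp
      ((hv.intervalIntegrable hb ht).sub intervalIntegrable_const)
  refine ⟨(continuous_apply j).comp_continuousOn hc, fun t ht =>
    (ContinuousLinearMap.proj (R := ℝ) (φ := fun _ : ControlIdx n => ℝ) j).intervalIntegrable_comp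
      (hw t ht), ?_, fun t ht => ?_⟩
  · filter_upwards [hb] with t ht h0 using hkey j _ (ht h0)
  · have hdev : IntervalIntegrable
        (fun τ => deviation aMin aMax uNom (zState Bd F (x τ ω) (y τ ω))) volume 0 t :=
      ((continuous_deviation hfeas).comp_continuousOn (hc.mono fun s hs => by
        rw [Set.uIcc_of_le ht] at hs; exact hs.1)).intervalIntegrable
    have h1 := (ContinuousLinearMap.proj (R := ℝ)
      (φ := fun _ : ControlIdx n => ℝ) j).intervalIntegral_comp_comm (hdev.sub (hw t ht))
    have h2 := congrFun (hz t ht) j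
    rw [h2, Pi.add_apply]
    congr 1
    exact h1.symm

/-- Independence enters only through uncorrelatedness. By linearity z_j w_j splits into an x-part
and a y-part, and each has mean zero since w does; joint independence of (x, y) from the fluctuation
is not needed. -/
lemma isDampedProcess [IsProbabilityMeasure μ] (hn : 0 < n)
    (hv : IsBoundedMeanErgodic μ V P v vNom)
    (hfeas : uNom ∈ feasible aMin aMax)
    (hinv : Matrix.fromRows (flowMatrix n) C * Matrix.fromCols Bd F = 1)
    (hxy : IsClosedLoop μ aMin aMax uNom C Bd F v vNom x y)
    (hx₀ : MemLp (x 0) 2 μ) (hy₀ : MemLp (y 0) 2 μ)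
    (hindx : ∀ t : ℝ, 0 ≤ t → IndepFun (x t) (fun ω => v t ω - vNom) μ)
    (hindy : ∀ t : ℝ, 0 ≤ t → IndepFun (y t) (fun ω => v t ω - vNom) μ) :
    ∃ M, ∀ j, IsDampedProcess μ (feedback aMin aMax uNom j) M
      (fun t ω => zState Bd F (x t ω) (y t ω) j) (fun t ω => Bd.mulVec (v t ω - vNom) j) := by
  obtain ⟨M, hM, hpath⟩ := hxy.exists_isDampedPath hn hv hfeas hinv
  have hzm : ∀ j t, 0 ≤ t → Measurable fun ω => zState Bd F (x t ω) (y t ω) j :=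
    fun j t ht => (measurable_pi_apply j).comp (hxy.measurable_zState ht)
  have hz0 : ∀ j, MemLp (fun ω => zState Bd F (x 0 ω) (y 0 ω) j) 2 μ := fun j =>
    memLp_pi_iff.1 (((mulVecCLM Bd).comp_memLp' hx₀).add ((mulVecCLM F).comp_memLp' hy₀)) j
  have hz : ∀ t, 0 ≤ t → Integrable (fun ω => zState Bd F (x t ω) (y t ω)) μ := fun t ht =>
    Integrable.of_eval fun j => (memLp_two_of_damped (isDamping_feedback hfeas j) (hzm j)
      (hpath j) (hz0 j) ht).integrable (by norm_num)
  -- Splitting the expectation requires x and y to be integrable separately. The energy estimates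
  -- control z, and x = Bz, y = Cz transfer the bound.
  have hx : ∀ t, 0 ≤ t → Integrable (x t) μ := fun t ht => by
    have h1 := (mulVecCLM (flowMatrix n)).integrable_comp (hz t ht)
    exact h1.congr (ae_of_all _ fun ω => flowMatrix_mulVec_zState hinv _ _)
  have hy : ∀ t, 0 ≤ t → Integrable (y t) μ := fun t ht => by
    have h1 := (mulVecCLM C).integrable_comp (hz t ht)
    exact h1.congr (ae_of_all _ fun ω => mulVec_zState hinv _ _)
  have hwm : Measurable fun p : ℝ × Ω => Bd.mulVec (v p.1 p.2 - vNom) :=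
    (mulVecCLM Bd).measurable.comp (hv.measurable.sub_const vNom)
  refine ⟨M, fun j => ⟨hzm j, (measurable_pi_apply j).comp hwm, hM j, hpath j, hz0 j,
    fun t ht => ?_⟩⟩
  set L : (Coalition n → ℝ) →L[ℝ] ℝ := (ContinuousLinearMap.proj (R := ℝ)
    (φ := fun _ : ControlIdx n => ℝ) j).comp (mulVecCLM Bd) with hL
  set L' : (Fin (n - 1) → ℝ) →L[ℝ] ℝ := (ContinuousLinearMap.proj (R := ℝ)
    (φ := fun _ : ControlIdx n => ℝ) j).comp (mulVecCLM F) with hL'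
  have hWint : Integrable (fun ω => v t ω - vNom) μ := (hv.integrable ht).sub (integrable_const _)
  have hW0 : ∫ ω, L (v t ω - vNom) ∂μ = 0 := by
    rw [L.integral_comp_comm hWint, integral_sub (hv.integrable ht) (integrable_const _),
      hv.mean t ht]
    simp
  have hWi : Integrable (fun ω => L (v t ω - vNom)) μ := L.integrable_comp hWint
  have hXi : Integrable (fun ω => L (x t ω)) μ := L.integrable_comp (hx t ht)
  have hYi : Integrable (fun ω => L' (y t ω)) μ := L'.integrable_comp (hy t ht)
  have hXW : IndepFun (fun ω => L (x t ω)) (fun ω => L (v t ω - vNom)) μ :=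
    (hindx t ht).comp L.measurable L.measurable
  have hYW : IndepFun (fun ω => L' (y t ω)) (fun ω => L (v t ω - vNom)) μ :=
    (hindy t ht).comp L'.measurable L.measurable
  have h1 := hXW.integral_mul_eq_mul_integral hXi.aestronglyMeasurable hWi.aestronglyMeasurable
  have h2 := hYW.integral_mul_eq_mul_integral hYi.aestronglyMeasurable hWi.aestronglyMeasurable
  rw [hW0, mul_zero] at h1 h2
  have h3 := integral_add (hXW.integrable_mul hXi hWi) (hYW.integrable_mul hYi hWi)
  rw [h1, h2, add_zero] at h3
  rw [← h3]
  refine integral_congr_ae (ae_of_all _ fun ω => ?_)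
  simp [hL, hL', zState, add_mul]

/-- The deviation of the excesses from the accumulated surplus is the state `x`. -/
lemma excess_sub_extendSurplus [SFinite μ] (hv : IsBoundedMeanErgodic μ V P v vNom)
    (hfeas : uNom ∈ feasible aMin aMax) (hbal : (flowMatrix n).mulVec uNom = vNom)
    (hxy : IsClosedLoop μ aMin aMax uNom C Bd F v vNom x y) :
    ∀ᵐ ω ∂μ, ∀ (u : ℝ → ControlIdx n → ℝ) (ε₀ : Coalition n → ℝ),
      (∀ t, u t = controller aMin aMax uNom (zState Bd F (x t ω) (y t ω))) → ∀ t, 0 ≤ t →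
      excess (fun τ i => u τ (Sum.inl i)) (fun τ => v τ ω) ε₀ t -
        extendSurplus (∫ τ in (0 : ℝ)..t, fun S => u τ (Sum.inr S)) = x t ω + (ε₀ - x 0 ω) := by
  obtain ⟨R, hR⟩ := hv.exists_bound
  filter_upwards [hxy.eq_x, hxy.continuousOn_zState, hv.ae_path_bound hR]
    with ω hx hc hb u ε₀ hu t ht
  have huc : ContinuousOn u (Set.uIcc 0 t) := by
    rw [funext hu]
    exact (continuous_controller hfeas).comp_continuousOn (hc.mono fun s hs => by
      rw [Set.uIcc_of_le ht] at hs; exact hs.1)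
  have hui : ∀ j, IntervalIntegrable (fun τ => u τ j) volume 0 t := fun j =>
    ((continuous_apply j).comp_continuousOn huc).intervalIntegrable
  have hvi := hv.intervalIntegrable hb ht
  have hvS : ∀ S, IntervalIntegrable (fun τ => v τ ω S) volume 0 t := fun S =>
    (ContinuousLinearMap.proj (R := ℝ) (φ := fun _ : Coalition n => ℝ) S).intervalIntegrable_comp
      hvi
  have hBu : IntervalIntegrable (fun τ => (flowMatrix n).mulVec (u τ)) volume 0 t :=
    (mulVecCLM (flowMatrix n)).intervalIntegrable_comp huc.intervalIntegrable
  -- Because B u_nom = v_nom, the drift B Δu - Δv equals Bu - v.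
  have hxt : x t ω = x 0 ω + ∫ τ in (0 : ℝ)..t, ((flowMatrix n).mulVec (u τ) - v τ ω) := by
    rw [hx t ht]
    congr 1
    refine intervalIntegral.integral_congr fun τ _ => ?_
    simp only [hu, controller, Matrix.mulVec_add, hbal]
    abel
  have hsurp : (∫ τ in (0 : ℝ)..t, fun S => u τ (Sum.inr S)) =
      fun S => ∫ τ in (0 : ℝ)..t, u τ (Sum.inr S) := by
    ext S
    have hs : IntervalIntegrable (fun τ => fun S : ProperCoalition n => u τ (Sum.inr S))
        volume 0 t :=
      (continuousOn_pi.2 fun S => (continuous_apply (Sum.inr S)).comp_continuousOn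
        huc).intervalIntegrable
    exact ((ContinuousLinearMap.proj (R := ℝ)
      (φ := fun _ : ProperCoalition n => ℝ) S).intervalIntegral_comp_comm hs).symm
  ext S
  have hxS := congrFun hxt S
  have hproj := (ContinuousLinearMap.proj (R := ℝ)
    (φ := fun _ : Coalition n => ℝ) S).intervalIntegral_comp_comm (hBu.sub hvi)
  have hcoord : (∫ τ in (0 : ℝ)..t, ((flowMatrix n).mulVec (u τ) - v τ ω)) S =
      ∫ τ in (0 : ℝ)..t, ((∑ i ∈ S.1, u τ (Sum.inl i)) -
        extendSurplus (fun T => u τ (Sum.inr T)) S - v τ ω S) := by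
    refine hproj.symm.trans (intervalIntegral.integral_congr fun τ _ => ?_)
    simp [flowMatrix_mulVec_apply]
  have hsum : IntervalIntegrable (fun τ => ∑ i ∈ S.1, u τ (Sum.inl i)) volume 0 t := by
    simpa only [Finset.sum_fn] using
      IntervalIntegrable.sum S.1 fun i _ => hui (Sum.inl i)
  have hext : IntervalIntegrable (fun τ => extendSurplus (fun T => u τ (Sum.inr T)) S)
        volume 0 t ∧
      ∫ τ in (0 : ℝ)..t, extendSurplus (fun T => u τ (Sum.inr T)) S =
        extendSurplus (fun T => ∫ τ in (0 : ℝ)..t, u τ (Sum.inr T)) S := by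
    by_cases h : S.1 = Finset.univ
    · simp [extendSurplus, h]
    · simpa [extendSurplus, h] using hui _
  rw [Pi.add_apply, hcoord, intervalIntegral.integral_sub (hsum.sub hext.1) (hvS S),
    intervalIntegral.integral_sub hsum hext.1, hext.2,
    intervalIntegral.integral_finsetSum fun i _ => hui _] at hxS
  simp only [Pi.sub_apply, Pi.add_apply, excess, hsurp, hxS]
  ring

end IsClosedLoop
end DynamicTU

/-! ### Convergence of allocations and excesses -/

theorem corollary1 {n : ℕ} (hn : 0 < n)
    {Ω : Type*} [MeasurableSpace Ω] (μ : Measure Ω) [IsProbabilityMeasure μ]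
    (V : Set (DynamicTU.Coalition n → ℝ))
    (P : Measure (DynamicTU.Coalition n → ℝ)) [IsProbabilityMeasure P]
    (v : ℝ → Ω → DynamicTU.Coalition n → ℝ) (vNom : DynamicTU.Coalition n → ℝ)
    (hv : DynamicTU.IsBoundedMeanErgodic μ V P v vNom)
    (aMin aMax aNom : Fin n → ℝ) (sNom : DynamicTU.ProperCoalition n → ℝ)
    (uNom : DynamicTU.ControlIdx n → ℝ) (huNom : uNom = Sum.elim aNom sNom)
    (hcore : aNom ∈ DynamicTU.core vNom)
    (hbal : Matrix.mulVec (DynamicTU.flowMatrix n) uNom = vNom)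
    (hfeas : uNom ∈ DynamicTU.feasible aMin aMax)
    (C : Matrix (Fin (n - 1)) (DynamicTU.ControlIdx n) ℝ)
    (Bd : Matrix (DynamicTU.ControlIdx n) (DynamicTU.Coalition n) ℝ)
    (F : Matrix (DynamicTU.ControlIdx n) (Fin (n - 1)) ℝ)
    (hinv : Matrix.fromRows (DynamicTU.flowMatrix n) C * Matrix.fromCols Bd F = 1)
    (x : ℝ → Ω → DynamicTU.Coalition n → ℝ) (y : ℝ → Ω → Fin (n - 1) → ℝ)
    (hxy : DynamicTU.IsClosedLoop μ aMin aMax uNom C Bd F v vNom x y)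
    (hx₀ : MemLp (x 0) 2 μ) (hy₀ : MemLp (y 0) 2 μ)
    (hindx : ∀ t : ℝ, 0 ≤ t → IndepFun (x t) (fun ω => v t ω - vNom) μ)
    (hindy : ∀ t : ℝ, 0 ≤ t → IndepFun (y t) (fun ω => v t ω - vNom) μ)
    (hreg : ((∀ i, aMin i < aNom i ∧ aNom i < aMax i) ∧ ∀ S, 0 < sNom S) ∨
      ∀ᵐ ω ∂μ, x 0 ω = 0 ∧ y 0 ω = 0)
    (ε₀ : Ω → DynamicTU.Coalition n → ℝ)
    (u : ℝ → Ω → DynamicTU.ControlIdx n → ℝ)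
    (hu : ∀ t ω, u t ω =
      DynamicTU.controller aMin aMax uNom (DynamicTU.zState Bd F (x t ω) (y t ω)))
    (a : ℝ → Ω → Fin n → ℝ) (ha : ∀ t ω i, a t ω i = u t ω (Sum.inl i))
    (s : ℝ → Ω → DynamicTU.ProperCoalition n → ℝ)
    (hs : ∀ t ω S, s t ω S = u t ω (Sum.inr S))
    (ε : ℝ → Ω → DynamicTU.Coalition n → ℝ)
    (hε : ∀ t ω, ε t ω =
      DynamicTU.excess (fun τ => a τ ω) (fun τ => v τ ω) (ε₀ ω) t) :
    (∀ t ω, u t ω ∈ DynamicTU.feasible aMin aMax) ∧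
    (∀ᵐ ω ∂μ, Tendsto (fun t => x t ω) atTop (𝓝 0)) ∧
    (∀ᵐ ω ∂μ, Tendsto (DynamicTU.timeAvg fun τ => a τ ω) atTop (𝓝 aNom)) ∧
    (∀ᵐ ω ∂μ, Tendsto (fun t => t⁻¹ • ε t ω) atTop (𝓝 (DynamicTU.extendSurplus sNom))) ∧
    (∀ᵐ ω ∂μ, Tendsto
      (fun t => ε t ω - DynamicTU.extendSurplus (∫ τ in (0 : ℝ)..t, s τ ω))
      atTop (𝓝 (ε₀ ω - x 0 ω))) ∧
    ((∀ᵐ ω ∂μ, x 0 ω = 0 ∧ y 0 ω = 0 ∧ ε₀ ω = 0) →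
      ∀ᵐ ω ∂μ, Tendsto (fun t => ε t ω - t • DynamicTU.extendSurplus sNom)
        atTop (𝓝 0)) := by
  have haN : ∀ i, uNom (Sum.inl i) = aNom i := fun i => by rw [huNom]; rfl
  have hsN : ∀ S, uNom (Sum.inr S) = sNom S := fun S => by rw [huNom]; rfl
  obtain ⟨M, hZ⟩ := hxy.isDampedProcess hn hv hfeas hinv hx₀ hy₀ hindx hindy
  have hdamp := DynamicTU.isDamping_feedback hfeas
  have hzero : (∀ᵐ ω ∂μ, x 0 ω = 0 ∧ y 0 ω = 0) →
      ∀ᵐ ω ∂μ, ∀ t, 0 ≤ t → DynamicTU.zState Bd F (x t ω) (y t ω) = 0 := by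
    intro h0
    have h1 : ∀ᵐ ω ∂μ, ∀ j, ∀ t, 0 ≤ t → DynamicTU.zState Bd F (x t ω) (y t ω) j = 0 := by
      refine ae_all_iff.2 fun j => (hZ j).eq_zero_of_zero (hdamp j) ?_
      filter_upwards [h0] with ω hω
      simp [DynamicTU.zState, hω.1, hω.2]
    filter_upwards [h1] with ω hω t ht using funext fun j => hω j t ht
  have hlim : ∀ᵐ ω ∂μ,
      Tendsto (fun t => DynamicTU.zState Bd F (x t ω) (y t ω)) atTop (𝓝 0) := by
    rcases hreg with ⟨hai, hsi⟩ | h0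
    · have h1 := ae_all_iff.2 fun j => (hZ j).tendsto_zero (hdamp j)
        (DynamicTU.isStrictDamping_feedback (fun i => by rw [haN]; exact hai i)
          (fun S => by rw [hsN]; exact hsi S) j)
      filter_upwards [h1] with ω hω using tendsto_pi_nhds.2 hω
    · filter_upwards [hzero h0] with ω hω
      refine tendsto_const_nhds.congr' ?_
      filter_upwards [eventually_ge_atTop 0] with t ht using (hω t ht).symm
  have hxlim : ∀ᵐ ω ∂μ, Tendsto (fun t => x t ω) atTop (𝓝 0) := by
    filter_upwards [hlim] with ω hω
    have h1 := ((DynamicTU.mulVecCLM (DynamicTU.flowMatrix n)).continuous.tendsto 0).comp hω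
    rw [map_zero] at h1
    exact h1.congr fun t => DynamicTU.flowMatrix_mulVec_zState hinv _ _
  have hucont : ∀ᵐ ω ∂μ, ContinuousOn (fun t => u t ω) (Set.Ici 0) := by
    filter_upwards [hxy.continuousOn_zState] with ω hω
    simp_rw [hu]
    exact (DynamicTU.continuous_controller hfeas).comp_continuousOn hω
  have hulim : ∀ᵐ ω ∂μ, Tendsto (fun t => u t ω) atTop (𝓝 uNom) := by
    filter_upwards [hlim] with ω hω
    have h1 := ((DynamicTU.continuous_controller hfeas).tendsto 0).comp hω
    rw [DynamicTU.controller_zero hfeas] at h1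
    exact h1.congr fun t => (hu t ω).symm
  have haeq : ∀ ω, (fun τ => a τ ω) = fun τ i => u τ ω (Sum.inl i) := fun ω =>
    funext fun τ => funext fun i => ha τ ω i
  have hseq : ∀ ω, (fun τ => s τ ω) = fun τ S => u τ ω (Sum.inr S) := fun ω =>
    funext fun τ => funext fun S => hs τ ω S
  have havg : ∀ᵐ ω ∂μ, Tendsto (DynamicTU.timeAvg fun τ => a τ ω) atTop (𝓝 aNom) := by
    filter_upwards [hucont, hulim] with ω hc hl
    rw [haeq]
    refine DynamicTU.tendsto_timeAvg
      (continuousOn_pi.2 fun i => (continuous_apply (Sum.inl i)).comp_continuousOn hc)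
      (tendsto_pi_nhds.2 fun i => ?_)
    rw [← haN i]
    exact tendsto_pi_nhds.1 hl _
  have hsavg : ∀ᵐ ω ∂μ, Tendsto (DynamicTU.timeAvg fun τ => s τ ω) atTop (𝓝 sNom) := by
    filter_upwards [hucont, hulim] with ω hc hl
    rw [hseq]
    refine DynamicTU.tendsto_timeAvg
      (continuousOn_pi.2 fun S => (continuous_apply (Sum.inr S)).comp_continuousOn hc)
      (tendsto_pi_nhds.2 fun S => ?_)
    rw [← hsN S]
    exact tendsto_pi_nhds.1 hl _
  have hexc : ∀ᵐ ω ∂μ, ∀ t, 0 ≤ t →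
      ε t ω - DynamicTU.extendSurplus (∫ τ in (0 : ℝ)..t, s τ ω) =
        x t ω + (ε₀ ω - x 0 ω) := by
    filter_upwards [hxy.excess_sub_extendSurplus hv hfeas hbal] with ω hω t ht
    have h1 := hω (fun τ => u τ ω) (ε₀ ω) (fun τ => hu τ ω) t ht
    rw [hε, haeq, hseq]
    exact h1
  have hexclim : ∀ᵐ ω ∂μ, Tendsto
      (fun t => ε t ω - DynamicTU.extendSurplus (∫ τ in (0 : ℝ)..t, s τ ω))
      atTop (𝓝 (ε₀ ω - x 0 ω)) := by
    filter_upwards [hexc, hxlim] with ω hω hl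
    have h1 := hl.add_const (ε₀ ω - x 0 ω)
    rw [zero_add] at h1
    refine h1.congr' ?_
    filter_upwards [eventually_ge_atTop 0] with t ht using (hω t ht).symm
  refine ⟨fun t ω => ?_, hxlim, havg, ?_, hexclim, fun h0 => ?_⟩
  · rw [hu]
    exact DynamicTU.controller_mem_feasible hfeas _
  · filter_upwards [hexclim, hsavg] with ω h1 h2
    -- ε/t is the time average of (s, 0) plus 1/t times a convergent quantity, which vanishes in the
    -- limit.
    have h3 := (tendsto_inv_atTop_zero (𝕜 := ℝ)).smul h1
    have h4 := ((DynamicTU.continuous_extendSurplus (n := n)).tendsto sNom).comp h2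
    have h5 := h3.add h4
    rw [zero_smul, zero_add] at h5
    refine h5.congr fun t => ?_
    simp only [Function.comp_apply, DynamicTU.timeAvg, DynamicTU.extendSurplus_smul, smul_sub,
      sub_add_cancel]
  · filter_upwards [hexclim, h0, hzero (h0.mono fun ω h => ⟨h.1, h.2.1⟩)] with ω h1 h2 h3
    rw [h2.1, h2.2.2, sub_zero] at h1
    refine h1.congr' ?_
    filter_upwards [eventually_ge_atTop 0] with t ht
    -- With zero initial state z ≡ 0, so the surplus equals s_nom at all times and its integral is
    -- exactly t s_nom; mere convergence of s would not suffice.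
    have h4 : ∫ τ in (0 : ℝ)..t, s τ ω = t • sNom := by
      rw [intervalIntegral.integral_congr (g := fun _ => sNom), intervalIntegral.integral_const,
        sub_zero]
      intro τ hτ
      rw [Set.uIcc_of_le ht] at hτ
      ext S
      show s τ ω S = sNom S
      rw [hs, hu, h3 τ hτ.1, DynamicTU.controller_zero hfeas, hsN]
    rw [h4, DynamicTU.extendSurplus_smul]
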